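/- All Borel spaces are standard and Hilbert spaces are separable, real or complex. Let $G$ be a Borel groupoid, that is, a groupoid with a standard Borel structure for which the unit space $G^{(0)}$, the range and source maps $r,s:G\to G^{(0)}$, the product and the inversion are Borel. Write $G|_A=\{\gamma: r(\gamma)\in A,\ s(\gamma)\in A\}$ and $G^x_A=\{\gamma : r(\gamma)=x,\ s(\gamma)\in A\}$ for $A\subset G^{(0)}$, $x\in G^{(0)}$. Let $C$ be a measure class on $G$ (the class of a probability measure), and let $r(C)$ be the class of $r_*\nu$ for $\nu\in C$ a probability measure. Null, conull and positive measure for sets of units refer to $r(C)$. Assume that $(G,C)$ is a measured groupoid: $C$ is symmetric (every $\nu\in C$ is equivalent to its image under inversion) and invariant (there are a probability measure $\nu\in C$, with a disintegration $\nu=\int\nu^x\,d(r_*\nu)(x)$ over $r$, and a conull set $U\subset G^{(0)}$ such that $\gamma\nu^{s(\gamma)}$ and $\nu^{r(\gamma)}$ are equivalent for every $\gamma\in G|_U$, where $\gamma\nu^{s(\gamma)}$ is the image of $\nu^{s(\gamma)}$ under $\gamma'\mapsto\gamma\gamma'$). $(G,C)$ is called ergodic if every Borel set $A\subset G^{(0)}$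 with $A=s(r^{-1}(A))$ is null or conull, and $r$-discrete if there is a conull set $U$ such that $G^x_U$ is countable for every $x\in U$. Let $\mathcal H=\{\mathcal H(x)\}_{x\in G^{(0)}}$ be a Hilbert bundle, that is, a family of Hilbert spaces with a standard Borel structure on $\{(x,v):v\in\mathcal H(x)\}$ such that a set of units is Borel if and only if its preimage under $(x,v)\mapsto x$ is Borel, and for which there is a sequence (called fundamental) of Borel sections $\xi_n$ such that the functions $(x,v)\mapsto\langle\xi_n(x),v\rangle$ and $x\mapsto\langle\xi_m(x),\xi_n(x)\rangle$ are Borel and, for each $x$, the functions $\langle\xi_n(x),\cdot\rangle$ separate the points of $\mathcal H(x)$. Let $L$ be a representation of $(G,C)$ in $\mathcal H$, that is, a family of bounded operators $L(\gamma):\mathcal H(s(\gamma))\to\mathcal H(r(\gamma))$, $\gamma\in G$, which is Borel (the functions $\gamma\mapsto\langle L(\gamma)\xi_n(s(\gamma)),\xi_m(r(\gamma))\rangle$ are Borel for a fundamental sequence) and for which there is a conull set $U$ such that for $\gamma\in G|_U$ the operator $L(\gamma)$ is an isometry onto $\mathcal H(r(\gamma))$, the identity if $\gamma$ is a unit, and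 $L(\gamma_1\gamma_2)=L(\gamma_1)L(\gamma_2)$ for composable $\gamma_1,\gamma_2\in G|_U$. Let $b$ be an $L$-cocycle, that is, a map $\gamma\mapsto b(\gamma)\in\mathcal H(r(\gamma))$ on $G$ such that $\gamma\mapsto(r(\gamma),b(\gamma))$ is Borel and, for some conull set $U$, $b(\gamma_1\gamma_2)=b(\gamma_1)+L(\gamma_1)b(\gamma_2)$ for all composable $\gamma_1,\gamma_2\in G|_U$. Consider the following conditions: (i) $b$ is an $L$-coboundary: there is a Borel section $\xi$ of $\mathcal H$ such that $b(\gamma)=\xi(r(\gamma))-L(\gamma)\xi(s(\gamma))$ for $C$-almost every $\gamma$; (ii) there is a Borel subset $E$ of $G^{(0)}$, of positive measure, such that $\sup\{\|b(\gamma)\|:\gamma\in G|_E\}<+\infty$; (iii) there is a Borel subset $E$ of $G^{(0)}$, of positive measure, such that for every $x\in E$, $\sup\{\|b(\gamma)\|:\gamma\in G^x_E\}<+\infty$. Then (i) $\Rightarrow$ (ii) $\Rightarrow$ (iii), and when $(G,C)$ is ergodic and $r$-discrete the three conditions are equivalent. -/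

import Mathlib

open CategoryTheory MeasureTheory ProbabilityTheory

universe u v w

/-! ### Measure classes -/

/-- A measure class on `α`: the set of all `σ`-finite measures having the same null sets as some
probability measure. -/
structure MeasureClass (α : Type u) [MeasurableSpace α] where
  /-- the measures that belong to the class -/
  carrier : Set (Measure α)
  exists_prob : ∃ ν : Measure α, IsProbabilityMeasure ν ∧
    carrier = {μ | SigmaFinite μ ∧ μ ≪ ν ∧ ν ≪ μ}

namespace MeasureClass

variable {α : Type u} [MeasurableSpace α]

/-- `A` is null for the measure class. -/
def IsNull (C : MeasureClass α) (A : Set α) : Prop := ∀ μ ∈ C.carrier, μ A = 0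

/-- `A` is conull for the measure class. -/
def IsConull (C : MeasureClass α) (A : Set α) : Prop := C.IsNull Aᶜ

/-- The property `p` holds almost everywhere for the measure class. -/
def AE (C : MeasureClass α) (p : α → Prop) : Prop := C.IsConull {a | p a}

/-- The measure class of the image `f_*(ν)` of any probability measure `ν` of the class `C`. -/
def map {β : Type v} [MeasurableSpace β] (C : MeasureClass α) (f : α → β) (hf : Measurable f) :
    MeasureClass β where
  carrier := {μ | SigmaFinite μ ∧ ∃ ν ∈ C.carrier, IsProbabilityMeasure ν ∧
    μ ≪ ν.map f ∧ ν.map f ≪ μ}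
  exists_prob := by
    obtain ⟨ν, hν, hC⟩ := C.exists_prob
    refine ⟨ν.map f, Measure.isProbabilityMeasure_map hf.aemeasurable, ?_⟩
    ext μ
    simp only [hC, Set.mem_ofPred_eq]
    constructor
    · rintro ⟨h, ν', ⟨-, h1, h2⟩, -, h3, h4⟩
      exact ⟨h, h3.trans (h1.map hf), (h2.map hf).trans h4⟩
    · rintro ⟨h, h1, h2⟩
      exact ⟨h, ν, ⟨inferInstance, .rfl, .rfl⟩, hν, h1, h2⟩

end MeasureClass

/-! ### Borel groupoids

A groupoid is a Mathlib groupoid `X`, the type `X` of objects being the unit space. An element `γ`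
of the groupoid is an arrow `γ : s(γ) ⟶ r(γ)`; the product `γ₁γ₂`, defined when `s(γ₁) = r(γ₂)`,
is `γ₂ ≫ γ₁`. -/

/-- The set of all elements (arrows) of a groupoid with unit space `X`. -/
@[ext]
structure Arr (X : Type u) [Groupoid.{v} X] where
  /-- the source `s(γ)` -/
  src : X
  /-- the range `r(γ)` -/
  rng : X
  /-- the arrow itself -/
  hom : src ⟶ rng

namespace Arr

variable {X : Type u} [Groupoid.{v} X]

/-- The unit at `x`. -/
def unit (x : X) : Arr X := ⟨x, x, 𝟙 x⟩

/-- The inverse `γ⁻¹`. -/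
def inv (γ : Arr X) : Arr X := ⟨γ.rng, γ.src, Groupoid.inv γ.hom⟩

/-- The product `γ₁γ₂` of two elements with `s(γ₁) = r(γ₂)`. -/
def mul (γ₁ γ₂ : Arr X) (h : γ₂.rng = γ₁.src) : Arr X :=
  ⟨γ₂.src, γ₁.rng, γ₂.hom ≫ eqToHom h ≫ γ₁.hom⟩

/-- The (elements of the) reduction `G|_A`. -/
def reduction (A : Set X) : Set (Arr X) := {γ | γ.rng ∈ A ∧ γ.src ∈ A}

/-- The set `G^x_A` of elements with range `x` and source in `A`. -/
def fibre (x : X) (A : Set X) : Set (Arr X) := {γ | γ.rng = x ∧ γ.src ∈ A}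

/-- The saturation `[A] = s(r⁻¹(A))`. -/
def saturation (A : Set X) : Set X := {x | ∃ γ : Arr X, γ.rng ∈ A ∧ γ.src = x}

end Arr

/-- A Borel groupoid: the elements and the units form standard Borel spaces and all the operations
are Borel maps. -/
class BorelGroupoid (X : Type u) [Groupoid.{v} X] [MeasurableSpace X] [MeasurableSpace (Arr X)] :
    Prop where
  standardBorel_units : StandardBorelSpace X
  standardBorel_arr : StandardBorelSpace (Arr X)
  measurable_src : Measurable (Arr.src : Arr X → X)
  measurable_rng : Measurable (Arr.rng : Arr X → X)
  measurable_unit : Measurable (Arr.unit : X → Arr X)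
  measurable_inv : Measurable (Arr.inv : Arr X → Arr X)
  measurable_mul : Measurable
    (fun p : {p : Arr X × Arr X // p.2.rng = p.1.src} => Arr.mul p.1.1 p.1.2 p.2)

section MeasuredGroupoid

variable {X : Type u} [Groupoid.{v} X] [MeasurableSpace X] [MeasurableSpace (Arr X)]

/-- The left translate `γ ρ` of (the restriction to the fibre `r⁻¹(s(γ))` of) a measure `ρ`:
the image of it under `γ' ↦ γγ'`. -/
noncomputable def Arr.translate (γ : Arr X) (ρ : Measure (Arr X)) : Measure (Arr X) :=
  (ρ.comap (Subtype.val : {γ' : Arr X // γ'.rng = γ.src} → Arr X)).map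
    (fun γ' => Arr.mul γ γ'.1 γ'.2)

/-- `κ = (ν^x)` is a disintegration of the probability measure `ν` with respect to the range map:
`ν^x` is a probability measure, which is carried by `r⁻¹(x)` for almost every `x`, and
`ν = ∫ ν^x d(r_*ν)(x)`. -/
structure IsRangeDisintegration (ν : Measure (Arr X)) (κ : Kernel X (Arr X)) : Prop where
  isMarkov : IsMarkovKernel κ
  ae_fibre : ∀ᵐ x ∂(ν.map Arr.rng), κ x {γ | γ.rng = x}ᶜ = 0
  bind_eq : (ν.map Arr.rng).bind κ = ν

variable [BorelGroupoid X]

/-- The measure class `r(C)` on the unit space. -/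
def MeasureClass.range (C : MeasureClass (Arr X)) : MeasureClass X :=
  C.map Arr.rng BorelGroupoid.measurable_rng

/-- `(G, C)` is a measured groupoid: the measure class `C` is symmetric and invariant. -/
structure IsMeasuredGroupoid (C : MeasureClass (Arr X)) : Prop where
  symmetric : ∀ ν ∈ C.carrier, ν.map Arr.inv ≪ ν ∧ ν ≪ ν.map Arr.inv
  invariant : ∃ ν ∈ C.carrier, IsProbabilityMeasure ν ∧
    ∃ κ : Kernel X (Arr X), IsRangeDisintegration ν κ ∧
      ∃ U : Set X, C.range.IsConull U ∧ ∀ γ ∈ Arr.reduction U,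
        γ.translate (κ γ.src) ≪ κ γ.rng ∧ κ γ.rng ≪ γ.translate (κ γ.src)

/-- Ergodicity: every invariant Borel set of units is null or conull for `r(C)`. -/
def IsErgodic (C : MeasureClass (Arr X)) : Prop :=
  ∀ A : Set X, MeasurableSet A → Arr.saturation A = A → C.range.IsNull A ∨ C.range.IsConull A

/-- `(G, C)` is `r`-discrete: some inessential reduction of it has countable range fibres. -/
def IsRDiscrete (C : MeasureClass (Arr X)) : Prop :=
  ∃ U : Set X, C.range.IsConull U ∧ ∀ x ∈ U, (Arr.fibre x U).Countable

end MeasuredGroupoid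

/-! ### Hilbert bundles -/

/-- The total space `X * H = {(x, v) : v ∈ H(x)}`. -/
structure BundleTotal {X : Type u} (H : X → Type w) where
  /-- the base point -/
  base : X
  /-- the vector -/
  vec : H base

section HilbertBundle

variable {X : Type u} [MeasurableSpace X] (H : X → Type w) [MeasurableSpace (BundleTotal H)]

/-- `ξ` is a Borel section of the bundle. -/
def IsBorelSection (ξ : ∀ x, H x) : Prop := Measurable (fun x => (⟨x, ξ x⟩ : BundleTotal H))

variable (𝕜 : Type*) [RCLike 𝕜] [∀ x, NormedAddCommGroup (H x)] [∀ x, InnerProductSpace 𝕜 (H x)]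

/-- A fundamental sequence of sections. -/
structure IsFundamental (ξ : ℕ → ∀ x, H x) : Prop where
  isBorelSection : ∀ n, IsBorelSection H (ξ n)
  measurable_coord : ∀ n, Measurable (fun t : BundleTotal H => inner 𝕜 (ξ n t.base) t.vec)
  measurable_gram : ∀ m n, Measurable (fun x => inner 𝕜 (ξ m x) (ξ n x))
  separates : ∀ (x : X) (v v' : H x), (∀ n, inner 𝕜 (ξ n x) v = inner 𝕜 (ξ n x) v') → v = v'

/-- A Hilbert bundle on `X`: a family of (real or complex) Hilbert spaces with a standard Borel
structure on the total space and a fundamental sequence of sections (so that the fibres are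
separable). -/
class IsHilbertBundle : Prop where
  completeSpace : ∀ x, CompleteSpace (H x)
  standardBorel : StandardBorelSpace (BundleTotal H)
  measurableSet_iff : ∀ E : Set X, MeasurableSet E ↔ MeasurableSet (BundleTotal.base (H := H) ⁻¹' E)
  exists_fundamental : ∃ ξ : ℕ → ∀ x, H x, IsFundamental H 𝕜 ξ

end HilbertBundle

/-! ### Representations and cocycles -/

section Cohomology

variable {X : Type u} [Groupoid.{v} X] [MeasurableSpace X] [MeasurableSpace (Arr X)]
  [BorelGroupoid X] (𝕜 : Type*) [RCLike 𝕜] (H : X → Type w) [MeasurableSpace (BundleTotal H)]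
  [∀ x, NormedAddCommGroup (H x)] [∀ x, InnerProductSpace 𝕜 (H x)]

/-- A representation of the measured groupoid `(G, C)` in the bundle `H`: a Borel family of
operators `L(γ) : H(s(γ)) → H(r(γ))` whose restriction to some inessential reduction `G|_U` is a
homomorphism into the groupoid of Hilbert isomorphisms between the fibres of `H`. No condition but
Borel measurability is imposed outside `G|_U`. -/
structure MeasuredRep (C : MeasureClass (Arr X)) where
  /-- the operator `L(γ)` -/
  op : ∀ ⦃x y : X⦄, (x ⟶ y) → (H x →L[𝕜] H y)
  borel : ∃ ξ : ℕ → ∀ x, H x, IsFundamental H 𝕜 ξ ∧ ∀ n m, Measurable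
    (fun γ : Arr X => inner 𝕜 (op γ.hom (ξ n γ.src)) (ξ m γ.rng))
  exists_reduction : ∃ U : Set X, C.range.IsConull U ∧
    (∀ ⦃x y : X⦄, x ∈ U → y ∈ U → ∀ γ : x ⟶ y,
      Isometry (op γ) ∧ Function.Surjective (op γ)) ∧
    (∀ ⦃x : X⦄, x ∈ U → ∀ v : H x, op (𝟙 x) v = v) ∧
    (∀ ⦃x y z : X⦄, x ∈ U → y ∈ U → z ∈ U → ∀ (γ₁ : y ⟶ z) (γ₂ : x ⟶ y) (v : H x),
      op (γ₂ ≫ γ₁) v = op γ₁ (op γ₂ v))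

variable {𝕜 H}

/-- `b` is an `L`-cocycle: a Borel section of the pull-back of `H` by the range map, satisfying
`b(γ₁γ₂) = b(γ₁) + L(γ₁) b(γ₂)` on some inessential reduction. -/
structure IsCocycle {C : MeasureClass (Arr X)} (L : MeasuredRep 𝕜 H C)
    (b : ∀ ⦃x y : X⦄, (x ⟶ y) → H y) : Prop where
  borel : Measurable (fun γ : Arr X => (⟨γ.rng, b γ.hom⟩ : BundleTotal H))
  exists_reduction : ∃ U : Set X, C.range.IsConull U ∧
    ∀ ⦃x y z : X⦄, x ∈ U → y ∈ U → z ∈ U → ∀ (γ₁ : y ⟶ z) (γ₂ : x ⟶ y),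
      b (γ₂ ≫ γ₁) = b γ₁ + L.op γ₁ (b γ₂)

/-- `b` is an `L`-coboundary: there is a Borel section `ξ` with
`b(γ) = ξ(r(γ)) - L(γ) ξ(s(γ))` for `C`-almost every `γ`. -/
def IsCoboundary {C : MeasureClass (Arr X)} (L : MeasuredRep 𝕜 H C)
    (b : ∀ ⦃x y : X⦄, (x ⟶ y) → H y) : Prop :=
  ∃ ξ : ∀ x, H x, IsBorelSection H ξ ∧
    C.AE (fun γ => b γ.hom = ξ γ.rng - L.op γ.hom (ξ γ.src))

end Cohomology

section Boundedness

variable {X : Type u} [Groupoid.{v} X] [MeasurableSpace X] [MeasurableSpace (Arr X)]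
  [BorelGroupoid X] {H : X → Type w} [∀ x, NormedAddCommGroup (H x)]

/-- There is a Borel set `E` of units, of positive measure, such that `b` is bounded on `G|_E`. -/
def IsBoundedOnReduction (C : MeasureClass (Arr X)) (b : ∀ ⦃x y : X⦄, (x ⟶ y) → H y) : Prop :=
  ∃ E : Set X, MeasurableSet E ∧ ¬ C.range.IsNull E ∧
    BddAbove ((fun γ : Arr X => ‖b γ.hom‖) '' Arr.reduction E)

/-- There is a Borel set `E` of units, of positive measure, such that `b` is bounded on `G^x_E`
for every `x ∈ E`. -/
def IsBoundedOnFibres (C : MeasureClass (Arr X)) (b : ∀ ⦃x y : X⦄, (x ⟶ y) → H y) : Prop :=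
  ∃ E : Set X, MeasurableSet E ∧ ¬ C.range.IsNull E ∧
    ∀ x ∈ E, BddAbove ((fun γ : Arr X => ‖b γ.hom‖) '' Arr.fibre x E)

end Boundedness

/-! A cocycle turns `L` into an action by affine isometries: `γ` sends `w` to `b(γ) + L(γ)w`, and
`b` is the coboundary of `ξ` exactly when `ξ` is equivariant for it.

If `b` is almost everywhere the coboundary of `ξ`, invariance of the measure class makes the
identity hold everywhere on an inessential reduction (`IsCocycle.exists_reduction_eq`). Some set
`{‖ξ‖ ≤ n}` has positive measure there, and `‖b‖ ≤ 2n` on its reduction because `L` is isometric.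
Boundedness on a reduction gives boundedness on fibres since `G^x_E ⊆ G|_E` for `x ∈ E`.

Conversely, let `B(x)` be the set of values of `b` on `G^x_E`. By the cocycle identity the affine
action carries `B(s(γ))` onto `B(r(γ))`, so `B(x)` is bounded and nonempty for almost every `x` in
the saturation of `E`, which is conull by ergodicity. A nonempty bounded subset of a Hilbert space
has a unique Chebyshev center, so taking centers gives an equivariant `ξ`.

Two measurability problems remain. The radii of `B(x)` are suprema over fibres, whose superlevel
sets are projections of Borel sets: analytic, hence measurable for every completed finite measure.
The saturation of `E` is also only analytic, whereas ergodicity concerns invariant Borel sets; an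
invariant separation theorem bridges the gap. -/

section Preliminaries

open Set Filter Topology

/-! ### Analytic sets -/

/-- Analytic sets are measurable with respect to the completion of every finite measure. -/
theorem MeasureTheory.AnalyticSet.nullMeasurableSet {α : Type*} [TopologicalSpace α] [T2Space α]
    [MeasurableSpace α] [OpensMeasurableSpace α] (μ : Measure α) [IsFiniteMeasure μ]
    {s : Set α} (hs : AnalyticSet s) : NullMeasurableSet s μ := by
  rw [AnalyticSet] at hs
  obtain rfl | ⟨f, hf, rfl⟩ := hs
  · exact nullMeasurableSet_empty
  let A : List ℕ → Set α := fun l => f '' {y | PiNat.res y l.length = l}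
  -- The hull keeps the outer measure of `A l`; the closure forces infinite branches of the scheme
  -- to converge.
  let T : List ℕ → Set α := fun l => toMeasurable μ (A l) ∩ closure (A l)
  have hAT : ∀ l, A l ⊆ T l := fun l => subset_inter (subset_toMeasurable _ _) subset_closure
  have hTm : ∀ l, MeasurableSet (T l) := fun l =>
    (measurableSet_toMeasurable _ _).inter isClosed_closure.measurableSet
  have hTμ : ∀ l, μ (T l) = μ (A l) := fun l =>
    le_antisymm ((measure_mono inter_subset_left).trans (measure_toMeasurable _).le)
      (measure_mono (hAT l))
  have hA : ∀ l, A l ⊆ ⋃ n, T (n :: l) := by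
    rintro l _ ⟨y, hy, rfl⟩
    refine mem_iUnion.2 ⟨y l.length, hAT _ ⟨y, ?_, rfl⟩⟩
    simpa [PiNat.res_succ] using hy
  have hnull : ∀ l, μ (T l \ ⋃ n, T (n :: l)) = 0 := by
    intro l
    have hU : MeasurableSet (⋃ n, T (n :: l)) := .iUnion fun n => hTm _
    have h1 := measure_inter_add_sdiff (μ := μ) (T l) hU
    have h2 : μ (T l) ≤ μ (T l ∩ ⋃ n, T (n :: l)) := by
      rw [hTμ]
      exact measure_mono (subset_inter (hAT l) (hA l))
    have h3 : μ (T l ∩ ⋃ n, T (n :: l)) ≠ ⊤ := measure_ne_top _ _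
    by_contra h0
    exact absurd (h1.le.trans h2) (not_le.2 (ENNReal.lt_add_right h3 h0))
  -- Outside the countably many null losses, a point of the root lies on an infinite branch `σ`. It
  -- is then in the closure of `f` of every cylinder around `σ`, so it equals `f σ` by continuity.
  have hsub : T [] \ (⋃ l, T l \ ⋃ n, T (n :: l)) ⊆ range f := by
    rintro x ⟨hx, hx'⟩
    have step : ∀ l, x ∈ T l → ∃ n, x ∈ T (n :: l) := by
      intro l hl
      by_contra h
      exact hx' (mem_iUnion.2 ⟨l, hl, fun h' => h (mem_iUnion.1 h')⟩)
    choose! g hg using step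
    let t : ℕ → List ℕ := fun k => Nat.rec [] (fun _ l => g l :: l) k
    let σ : ℕ → ℕ := fun k => g (t k)
    have hres : ∀ k, PiNat.res σ k = t k := by
      intro k
      induction k with
      | zero => rfl
      | succ k ih => rw [PiNat.res_succ, ih]
    have ht : ∀ k, x ∈ T (t k) := by
      intro k
      induction k with
      | zero => exact hx
      | succ k ih => exact hg _ ih
    refine ⟨σ, ?_⟩
    by_contra hne
    obtain ⟨V, W, hV, hW, hσV, hxW, hVW⟩ := t2_separation hne
    obtain ⟨k, hk⟩ : ∃ k, PiNat.cylinder σ k ⊆ f ⁻¹' V := by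
      obtain ⟨_, ⟨y, k, rfl⟩, hy, hsub⟩ :=
        (PiNat.isTopologicalBasis_cylinders (fun _ : ℕ => ℕ)).exists_subset_of_mem_open
          (show σ ∈ f ⁻¹' V from hσV) (hV.preimage hf)
      exact ⟨k, by rwa [PiNat.mem_cylinder_iff_eq.1 hy]⟩
    obtain ⟨_, hzW, y, hy, rfl⟩ := mem_closure_iff.1 (ht k).2 W hW hxW
    refine disjoint_left.1 hVW (hk ?_) hzW
    rw [PiNat.cylinder_eq_res]
    have hlen : (t k).length = k := by rw [← hres, PiNat.res_length]
    simpa [hlen, hres] using hy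
  have hle : range f ⊆ T [] := by
    rintro _ ⟨y, rfl⟩
    exact hAT _ ⟨y, by simp, rfl⟩
  have hae : T [] =ᵐ[μ] range f := by
    refine ae_eq_set.2 ⟨measure_mono_null ?_ (measure_iUnion_null hnull), ?_⟩
    · intro x hx
      by_contra h
      exact hx.2 (hsub ⟨hx.1, h⟩)
    · rw [sdiff_eq_bot_iff.2 hle]; simp
  exact (hTm []).nullMeasurableSet.congr hae

theorem MeasurableSet.nullMeasurableSet_image {α β : Type*} [MeasurableSpace α]
    [StandardBorelSpace α] [MeasurableSpace β] [StandardBorelSpace β] (μ : Measure β)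
    [IsFiniteMeasure μ] {f : α → β} (hf : Measurable f) {s : Set α} (hs : MeasurableSet s) :
    NullMeasurableSet (f '' s) μ := by
  let _ := upgradeStandardBorel β
  exact (hs.analyticSet_image hf).nullMeasurableSet μ

/-- An invariant form of Lusin's separation theorem: `q` is a closure operator that preserves
analyticity of Borel sets. -/
theorem exists_measurableSet_eq_of_disjoint {α : Type*} [MeasurableSpace α] [TopologicalSpace α]
    [PolishSpace α] [BorelSpace α] {q : Set α → Set α}
    (hq : ∀ s, MeasurableSet s → AnalyticSet (q s)) (hsub : ∀ s, s ⊆ q s)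
    (hU : ∀ s : ℕ → Set α, q (⋃ n, s n) = ⋃ n, q (s n)) {A A' : Set α}
    (hA : AnalyticSet A) (hA' : AnalyticSet A') (hd : Disjoint A A')
    (hq' : ∀ s, Disjoint s A' → Disjoint (q s) A') :
    ∃ B, MeasurableSet B ∧ q B = B ∧ A ⊆ B ∧ Disjoint B A' := by
  have step : ∀ s : {s : Set α // AnalyticSet s ∧ Disjoint s A'},
      ∃ B, MeasurableSet B ∧ s.1 ⊆ B ∧ Disjoint B A' := by
    rintro ⟨s, hs, hd⟩
    obtain ⟨B, h1, h2, h3⟩ := hs.measurablySeparable hA' hd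
    exact ⟨B, h3, h1, h2.symm⟩
  choose F hFm hF hFd using step
  -- Alternate Borel separation from `A'` with `q`: since `q (F (t n)) ⊆ F (t (n + 1))`, the union
  -- of the Borel sets is fixed by `q`.
  let t : ℕ → {s : Set α // AnalyticSet s ∧ Disjoint s A'} := fun n =>
    Nat.rec ⟨A, hA, hd⟩ (fun _ s => ⟨q (F s), hq _ (hFm s), hq' _ (hFd s)⟩) n
  refine ⟨⋃ n, F (t n), .iUnion fun n => hFm _, ?_, ?_, ?_⟩
  · refine Subset.antisymm ?_ (hsub _)
    rw [hU]
    exact iUnion_subset fun n => subset_iUnion_of_subset (n + 1) (hF (t (n + 1)))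
  · exact subset_iUnion_of_subset 0 (hF (t 0))
  · exact disjoint_iUnion_left.2 fun n => hFd _

/-! ### Chebyshev centers in Hilbert spaces -/

section Center

open scoped ENNReal

/-- The radius of the smallest closed ball around `v` that contains `B`. -/
noncomputable def supDist {E : Type*} [PseudoEMetricSpace E] (B : Set E) (v : E) : ℝ≥0∞ :=
  ⨆ p ∈ B, edist p v

/-- `c` is a Chebyshev center of `B`. -/
def IsChebyshevCenter {E : Type*} [PseudoEMetricSpace E] (B : Set E) (c : E) : Prop :=
  ∀ v, supDist B c ≤ supDist B v

theorem supDist_le_add {E : Type*} [PseudoEMetricSpace E] (B : Set E) (v w : E) :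
    supDist B v ≤ supDist B w + edist w v :=
  iSup₂_le fun p hp => (edist_triangle p w v).trans
    (add_le_add_left (le_iSup₂ (f := fun p (_ : p ∈ B) => edist p w) p hp) _)

/-- `supDist B` is bounded above near each point by its value plus the displacement, so a dense
sequence sees its infimum. This makes the Chebyshev radius a countable infimum. -/
theorem iInf_supDist_of_denseRange {E ι : Type*} [PseudoEMetricSpace E] (B : Set E) {u : ι → E}
    (hu : DenseRange u) : ⨅ k, supDist B (u k) = ⨅ v, supDist B v := by
  refine le_antisymm (le_iInf fun v => ENNReal.le_of_forall_pos_le_add fun ε hε _ => ?_)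
    (le_iInf fun k => iInf_le _ _)
  obtain ⟨_, ⟨k, rfl⟩, hk⟩ := EMetric.mem_closure_iff.1 (hu v) ε (by exact_mod_cast hε)
  exact (iInf_le _ k).trans ((supDist_le_add B (u k) v).trans (add_le_add_right hk.le _))

theorem supDist_image {E F : Type*} [PseudoEMetricSpace E] [PseudoEMetricSpace F] {e : E → F}
    (he : Isometry e) (B : Set E) (v : E) : supDist (e '' B) (e v) = supDist B v := by
  simp only [supDist, iSup_image, he.edist_eq]

theorem IsChebyshevCenter.image {E F : Type*} [PseudoEMetricSpace E] [PseudoEMetricSpace F]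
    {e : E → F} (he : Isometry e) (hs : Function.Surjective e) {B : Set E} {c : E}
    (hc : IsChebyshevCenter B c) : IsChebyshevCenter (e '' B) (e c) := by
  intro w
  obtain ⟨v, rfl⟩ := hs w
  rw [supDist_image he, supDist_image he]
  exact hc v

/-- By the parallelogram law the midpoint of `u` and `v` is within `√(a² - d²/4)` of every point of
`B`, where `d = dist u v`; this cannot be less than `R`. Both uniqueness of the center and
convergence of minimizing sequences follow. -/
theorem dist_sq_le_of_supDist_le (𝕜 : Type*) {E : Type*} [RCLike 𝕜] [NormedAddCommGroup E]
    [InnerProductSpace 𝕜 E] {B : Set E} (hB : B.Nonempty) {u v : E} {a R : ℝ} (ha : 0 ≤ a)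
    (hR : 0 ≤ R) (hu : supDist B u ≤ ENNReal.ofReal a) (hv : supDist B v ≤ ENNReal.ofReal a)
    (hRle : ∀ w, ENNReal.ofReal R ≤ supDist B w) : dist u v ^ 2 ≤ 4 * (a ^ 2 - R ^ 2) := by
  have key : ∀ {w : E}, supDist B w ≤ ENNReal.ofReal a → ∀ p ∈ B, ‖p - w‖ ≤ a := by
    intro w hw p hp
    have h := (le_iSup₂ (f := fun p (_ : p ∈ B) => edist p w) p hp).trans hw
    rwa [edist_dist, ENNReal.ofReal_le_ofReal_iff ha, dist_eq_norm] at h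
  let m : E := (2⁻¹ : 𝕜) • (u + v)
  have hm : ∀ p ∈ B, ‖p - m‖ ^ 2 ≤ a ^ 2 - dist u v ^ 2 / 4 := by
    intro p hp
    have h1 := parallelogram_law_with_norm 𝕜 (p - u) (p - v)
    have e1 : p - u + (p - v) = (2 : 𝕜) • (p - m) := by
      simp only [m, smul_sub, smul_smul]
      rw [mul_inv_cancel₀ two_ne_zero, one_smul, two_smul]
      abel
    have e2 : p - u - (p - v) = v - u := by abel
    rw [e1, e2, norm_smul, ← dist_eq_norm v u, dist_comm v u, RCLike.norm_ofNat] at h1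
    have h2 := key hu p hp
    have h3 := key hv p hp
    have h4 := mul_self_le_mul_self (norm_nonneg _) h2
    have h5 := mul_self_le_mul_self (norm_nonneg _) h3
    nlinarith
  -- A point of `B` makes the radicand nonnegative; for empty `B` the estimate fails.
  obtain ⟨p, hp⟩ := hB
  have h0 : 0 ≤ a ^ 2 - dist u v ^ 2 / 4 := (sq_nonneg _).trans (hm p hp)
  have h1 : supDist B m ≤ ENNReal.ofReal (√(a ^ 2 - dist u v ^ 2 / 4)) := by
    refine iSup₂_le fun p hp => ?_
    rw [edist_dist, dist_eq_norm]
    exact ENNReal.ofReal_le_ofReal (Real.le_sqrt_of_sq_le (hm p hp))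
  have h2 := (ENNReal.ofReal_le_ofReal_iff (Real.sqrt_nonneg _)).1 ((hRle m).trans h1)
  have h3 := (Real.le_sqrt hR h0).1 h2
  linarith

/-- Both centers attain the minimal radius, so the midpoint estimate with `a = R` gives distance
zero. -/
theorem IsChebyshevCenter.eq (𝕜 : Type*) {E : Type*} [RCLike 𝕜] [NormedAddCommGroup E]
    [InnerProductSpace 𝕜 E] {B : Set E} (hB : B.Nonempty) {c c' : E} (hc : IsChebyshevCenter B c)
    (hc' : IsChebyshevCenter B c') (hfin : supDist B c ≠ ⊤) : c = c' := by
  have h := dist_sq_le_of_supDist_le 𝕜 hB (u := c) (v := c') (a := (supDist B c).toReal)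
    (R := (supDist B c).toReal) ENNReal.toReal_nonneg ENNReal.toReal_nonneg
    (by rw [ENNReal.ofReal_toReal hfin]) (by rw [ENNReal.ofReal_toReal hfin]; exact hc' c)
    (by rw [ENNReal.ofReal_toReal hfin]; exact hc)
  rw [sub_self, mul_zero] at h
  exact dist_eq_zero.1 (pow_eq_zero_iff two_ne_zero |>.1 (le_antisymm h (sq_nonneg _)))

/-- A minimizing sequence converges to the Chebyshev center. -/
theorem exists_tendsto_isChebyshevCenter (𝕜 : Type*) {E : Type*} [RCLike 𝕜] [NormedAddCommGroup E]
    [InnerProductSpace 𝕜 E] [CompleteSpace E] {B : Set E} (hB : B.Nonempty)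
    (hfin : ⨅ v, supDist B v ≠ ⊤) {w : ℕ → E}
    (hw : ∀ j, supDist B (w j) ≤ (⨅ v, supDist B v) + ENNReal.ofReal (1 / (j + 1))) :
    ∃ c, Tendsto w atTop (𝓝 c) ∧ IsChebyshevCenter B c := by
  set R := (⨅ v, supDist B v).toReal with hRdef
  have hR0 : 0 ≤ R := ENNReal.toReal_nonneg
  have hR : ENNReal.ofReal R = ⨅ v, supDist B v := ENNReal.ofReal_toReal hfin
  have hw' : ∀ j n : ℕ, n ≤ j → supDist B (w j) ≤ ENNReal.ofReal (R + 1 / (n + 1)) := by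
    intro j n hn
    rw [ENNReal.ofReal_add hR0 (by positivity), hR]
    exact (hw j).trans (by gcongr)
  have hlim : Tendsto (fun n : ℕ => √(4 * ((R + 1 / (n + 1 : ℝ)) ^ 2 - R ^ 2))) atTop (𝓝 0) := by
    have h1 : Tendsto (fun n : ℕ => (1 : ℝ) / (n + 1)) atTop (𝓝 0) :=
      tendsto_one_div_add_atTop_nhds_zero_nat
    have h2 := (((((h1.const_add R).pow 2).sub_const (R ^ 2)).const_mul 4).sqrt)
    simpa using h2
  have hC : CauchySeq w := by
    refine cauchySeq_of_le_tendsto_0 _ (fun i j n hi hj => Real.le_sqrt_of_sq_le ?_) hlim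
    exact dist_sq_le_of_supDist_le 𝕜 hB (by positivity) hR0 (hw' i n hi) (hw' j n hj)
      (fun v => hR ▸ iInf_le _ v)
  obtain ⟨c, hc⟩ := cauchySeq_tendsto_of_complete hC
  refine ⟨c, hc, fun v => le_trans ?_ (iInf_le _ v)⟩
  have h1 : Tendsto (fun j : ℕ => (⨅ v, supDist B v) + ENNReal.ofReal (1 / (j + 1)) +
      edist (w j) c) atTop (𝓝 ((⨅ v, supDist B v) + ENNReal.ofReal 0 + 0)) :=
    ((ENNReal.tendsto_ofReal tendsto_one_div_add_atTop_nhds_zero_nat).const_add _).add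
      (tendsto_iff_edist_tendsto_0.1 hc)
  rw [ENNReal.ofReal_zero, add_zero, add_zero] at h1
  exact ge_of_tendsto' h1 fun j => (supDist_le_add B c (w j)).trans (by gcongr; exact hw j)

end Center

/-! ### Borel sections of Hilbert bundles -/

section Sections

variable {X : Type u} [MeasurableSpace X] {H : X → Type w} [MeasurableSpace (BundleTotal H)]
  {𝕜 : Type*} [RCLike 𝕜] [∀ x, NormedAddCommGroup (H x)] [∀ x, InnerProductSpace 𝕜 (H x)]

theorem measurable_bundleTotal_base (H : X → Type w) [MeasurableSpace (BundleTotal H)]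
    (𝕜 : Type*) [RCLike 𝕜] [∀ x, NormedAddCommGroup (H x)] [∀ x, InnerProductSpace 𝕜 (H x)]
    [hH : IsHilbertBundle H 𝕜] : Measurable (BundleTotal.base : BundleTotal H → X) :=
  fun E hE => (hH.measurableSet_iff E).1 hE

namespace IsFundamental

variable {ξ : ℕ → ∀ x, H x}

/-- An injective Borel map between standard Borel spaces is an embedding (Lusin–Souslin). Hence
measurability into the bundle can be tested on coordinates. -/
theorem measurableEmbedding_coord [StandardBorelSpace X] [hH : IsHilbertBundle H 𝕜]
    (hξ : IsFundamental H 𝕜 ξ) : MeasurableEmbedding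
      (fun t : BundleTotal H => (t.base, fun n => inner 𝕜 (ξ n t.base) t.vec)) := by
  have := hH.standardBorel
  refine Measurable.measurableEmbedding
    ((measurable_bundleTotal_base H 𝕜).prodMk (measurable_pi_iff.2 hξ.measurable_coord)) ?_
  rintro ⟨x, p⟩ ⟨y, q⟩ h
  obtain ⟨rfl, h⟩ := Prod.mk.inj h
  rw [hξ.separates x p q fun n => congrFun h n]

theorem isBorelSection_iff [StandardBorelSpace X] [IsHilbertBundle H 𝕜]
    (hξ : IsFundamental H 𝕜 ξ) {η : ∀ x, H x} :
    IsBorelSection H η ↔ ∀ n, Measurable (fun x => inner 𝕜 (ξ n x) (η x)) := by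
  refine ⟨fun h n => (hξ.measurable_coord n).comp h, fun h => ?_⟩
  rw [IsBorelSection, ← hξ.measurableEmbedding_coord.measurable_comp_iff]
  exact measurable_id.prodMk (measurable_pi_iff.2 h)

/-- The separation property says that the span has trivial orthogonal complement. Lists of
(coefficient, section) indices give a countable family closed under addition, whose closure contains
the span. -/
theorem denseRange_combination (hξ : IsFundamental H 𝕜 ξ) {x : X} [CompleteSpace (H x)] :
    DenseRange (fun l : List (ℕ × ℕ) =>
      (l.map fun p => TopologicalSpace.denseSeq 𝕜 p.1 • ξ p.2 x).sum) := by
  let M : AddSubmonoid (H x) :=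
    { carrier := range (fun l : List (ℕ × ℕ) =>
        (l.map fun p => TopologicalSpace.denseSeq 𝕜 p.1 • ξ p.2 x).sum)
      zero_mem' := ⟨[], by simp⟩
      add_mem' := by
        rintro _ _ ⟨l, rfl⟩ ⟨l', rfl⟩
        exact ⟨l ++ l', by simp⟩ }
  let K : Submodule 𝕜 (H x) := Submodule.span 𝕜 (range fun n => ξ n x)
  have hK : K.topologicalClosure = ⊤ := by
    rw [Submodule.topologicalClosure_eq_top_iff, Submodule.eq_bot_iff]
    intro w hw
    refine hξ.separates x w 0 fun n => ?_
    rw [inner_zero_right]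
    exact hw _ (Submodule.subset_span ⟨n, rfl⟩)
  have hKM : K.toAddSubmonoid ≤ M.topologicalClosure := by
    rw [Submodule.span_eq_closure, AddSubmonoid.closure_le]
    rintro _ ⟨c, -, _, ⟨n, rfl⟩, rfl⟩
    have hc := (TopologicalSpace.denseRange_denseSeq 𝕜) c
    refine map_mem_closure (f := fun c : 𝕜 => c • ξ n x) (by fun_prop) hc ?_
    rintro _ ⟨k, rfl⟩
    exact ⟨[(k, n)], by simp⟩
  intro w
  have hw : w ∈ K.topologicalClosure := hK ▸ Submodule.mem_top
  exact closure_minimal (show (K : Set (H x)) ⊆ M.topologicalClosure from hKM)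
    M.isClosed_topologicalClosure hw

/-- A Hilbert bundle has a fundamental sequence that is dense in every fibre. -/
theorem exists_denseRange [StandardBorelSpace X] [hH : IsHilbertBundle H 𝕜]
    (hξ : IsFundamental H 𝕜 ξ) :
    ∃ v : ℕ → ∀ x, H x, IsFundamental H 𝕜 v ∧ ∀ x, DenseRange fun k => v k x := by
  let c : List (ℕ × ℕ) → ∀ x, H x := fun l x =>
    (l.map fun p => TopologicalSpace.denseSeq 𝕜 p.1 • ξ p.2 x).sum
  have hcons : ∀ p l x, c (p :: l) x = TopologicalSpace.denseSeq 𝕜 p.1 • ξ p.2 x + c l x :=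
    fun p l x => by simp [c]
  have hnil : ∀ x, c [] x = 0 := fun x => by simp [c]
  have hc1 : ∀ l, Measurable (fun t : BundleTotal H => inner 𝕜 (c l t.base) t.vec) := by
    intro l
    induction l with
    | nil => simp only [hnil, inner_zero_left, measurable_const]
    | cons p l ih =>
      simp only [hcons, inner_add_left, inner_smul_left]
      exact ((hξ.measurable_coord p.2).const_mul _).add ih
  have hc2 : ∀ l, IsBorelSection H (c l) := by
    intro l
    rw [hξ.isBorelSection_iff]
    intro n
    induction l with
    | nil => simp only [hnil, inner_zero_right, measurable_const]
    | cons p l ih =>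
      simp only [hcons, inner_add_right, inner_smul_right]
      exact ((hξ.measurable_gram n p.2).const_mul _).add ih
  obtain ⟨e, he⟩ := exists_surjective_nat (List (ℕ × ℕ))
  have hd : ∀ x, DenseRange fun k => c (e k) x := fun x => by
    have := hH.completeSpace x
    have h := hξ.denseRange_combination (x := x)
    rw [DenseRange, ← he.range_comp] at h
    exact h
  refine ⟨fun k => c (e k), ⟨fun n => hc2 _, fun n => hc1 _, fun m n => ?_, ?_⟩, hd⟩
  · exact (hc1 (e m)).comp (hc2 (e n))
  · intro x p q h
    refine sub_eq_zero.1 ((hd x).eq_zero_of_inner_right 𝕜 ?_)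
    intro k
    simp [inner_sub_right, h k]

theorem measurable_norm_section (hξ : IsFundamental H 𝕜 ξ) (n : ℕ) :
    Measurable (fun x => ‖ξ n x‖) := by
  have h : (fun x => ‖ξ n x‖) = fun x => √(RCLike.re (inner 𝕜 (ξ n x) (ξ n x))) :=
    funext fun x => norm_eq_sqrt_re_inner (𝕜 := 𝕜) _
  rw [h]
  exact (RCLike.continuous_re.measurable.comp (hξ.measurable_gram n n)).sqrt

end IsFundamental

/-- Testing on `w` itself, a limit of the `v k`, recovers the norm, so a norm bound becomes
countably many conditions on coordinates. The clause `0 ≤ a` matters only in the zero space. -/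
theorem norm_le_iff_of_denseRange {E ι : Type*} [NormedAddCommGroup E] [InnerProductSpace 𝕜 E]
    {v : ι → E} (hv : DenseRange v) {w : E} {a : ℝ} :
    ‖w‖ ≤ a ↔ 0 ≤ a ∧ ∀ k, ‖(inner 𝕜 (v k) w : 𝕜)‖ ≤ a * ‖v k‖ := by
  refine ⟨fun h => ⟨(norm_nonneg _).trans h, fun k => (norm_inner_le_norm _ _).trans ?_⟩, ?_⟩
  · rw [mul_comm]
    gcongr
  · rintro ⟨ha, h⟩
    have h1 : ∀ u : E, ‖(inner 𝕜 u w : 𝕜)‖ ≤ a * ‖u‖ := fun u =>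
      hv.induction_on (p := fun u => ‖(inner 𝕜 u w : 𝕜)‖ ≤ a * ‖u‖) u
        (isClosed_le (by fun_prop) (by fun_prop)) h
    have h2 := h1 w
    rw [inner_self_eq_norm_sq_to_K, norm_pow, RCLike.norm_ofReal, abs_norm] at h2
    rcases eq_or_lt_of_le (norm_nonneg w) with h0 | h0
    · rwa [← h0]
    · nlinarith

/-- The distance to a Borel section is a Borel function on the total space. -/
theorem IsBorelSection.measurable_norm_sub [StandardBorelSpace X] [hH : IsHilbertBundle H 𝕜]
    {η : ∀ x, H x} (hη : IsBorelSection H η) :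
    Measurable (fun t : BundleTotal H => ‖t.vec - η t.base‖) := by
  obtain ⟨ξ, hξ⟩ := hH.exists_fundamental
  obtain ⟨v, hv, hd⟩ := hξ.exists_denseRange
  have hb := measurable_bundleTotal_base H 𝕜
  refine measurable_of_Iic fun a => ?_
  have h : (fun t : BundleTotal H => ‖t.vec - η t.base‖) ⁻¹' Iic a = {_t | 0 ≤ a} ∩ ⋂ k,
      {t | ‖(inner 𝕜 (v k t.base) t.vec - inner 𝕜 (v k t.base) (η t.base) : 𝕜)‖ ≤
        a * ‖v k t.base‖} := by
    ext t
    simp only [mem_preimage, mem_Iic, mem_inter_iff, mem_iInter, mem_ofPred_eq]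
    rw [norm_le_iff_of_denseRange (𝕜 := 𝕜) (hd t.base)]
    simp only [inner_sub_right]
  rw [h]
  refine (MeasurableSet.const _).inter (.iInter fun k => measurableSet_le ?_ ?_)
  · exact ((hv.measurable_coord k).sub (((hv.measurable_coord k).comp hη).comp hb)).norm
  · exact ((hv.measurable_norm_section k).comp hb).const_mul a

theorem isBorelSection_zero (H : X → Type w) [MeasurableSpace (BundleTotal H)]
    (𝕜 : Type*) [RCLike 𝕜] [∀ x, NormedAddCommGroup (H x)] [∀ x, InnerProductSpace 𝕜 (H x)]
    [StandardBorelSpace X] [hH : IsHilbertBundle H 𝕜] : IsBorelSection H (fun _ => 0) := by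
  obtain ⟨ξ, hξ⟩ := hH.exists_fundamental
  exact hξ.isBorelSection_iff.2 fun n => by simp

theorem IsBorelSection.measurable_norm [StandardBorelSpace X] [IsHilbertBundle H 𝕜]
    {η : ∀ x, H x} (hη : IsBorelSection H η) : Measurable (fun x => ‖η x‖) := by
  have h := (isBorelSection_zero H 𝕜).measurable_norm_sub (𝕜 := 𝕜)
  simpa [Function.comp_def] using h.comp hη

end Sections

/-! ### Measure classes and inessential reductions -/

namespace MeasureClass

variable {α : Type u} [MeasurableSpace α]

theorem exists_isProbabilityMeasure_mem (C : MeasureClass α) :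
    ∃ ν ∈ C.carrier, IsProbabilityMeasure ν := by
  obtain ⟨ν, hν, hC⟩ := C.exists_prob
  exact ⟨ν, hC ▸ ⟨inferInstance, .rfl, .rfl⟩, hν⟩

theorem absolutelyContinuous (C : MeasureClass α) {μ ν : Measure α} (hμ : μ ∈ C.carrier)
    (hν : ν ∈ C.carrier) : μ ≪ ν := by
  obtain ⟨ρ, hρ, hC⟩ := C.exists_prob
  rw [hC] at hμ hν
  exact hμ.2.1.trans hν.2.2

theorem isNull_iff (C : MeasureClass α) {ν : Measure α} (hν : ν ∈ C.carrier) {A : Set α} :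
    C.IsNull A ↔ ν A = 0 :=
  ⟨fun h => h ν hν, fun h _ hμ => C.absolutelyContinuous hμ hν h⟩

theorem IsNull.mono {C : MeasureClass α} {A B : Set α} (hB : C.IsNull B) (h : A ⊆ B) :
    C.IsNull A := fun μ hμ => measure_mono_null h (hB μ hμ)

theorem IsNull.union {C : MeasureClass α} {A B : Set α} (hA : C.IsNull A) (hB : C.IsNull B) :
    C.IsNull (A ∪ B) := fun μ hμ => measure_union_null (hA μ hμ) (hB μ hμ)

theorem IsConull.mono {C : MeasureClass α} {A B : Set α} (hA : C.IsConull A) (h : A ⊆ B) :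
    C.IsConull B := IsNull.mono hA (compl_subset_compl.2 h)

theorem IsConull.inter {C : MeasureClass α} {A B : Set α} (hA : C.IsConull A)
    (hB : C.IsConull B) : C.IsConull (A ∩ B) := by
  rw [IsConull, compl_inter]
  exact IsNull.union hA hB

theorem IsConull.exists_measurableSet_subset {C : MeasureClass α} {A : Set α}
    (hA : C.IsConull A) : ∃ B ⊆ A, MeasurableSet B ∧ C.IsConull B := by
  obtain ⟨ν, hν, -⟩ := C.exists_isProbabilityMeasure_mem
  refine ⟨(toMeasurable ν Aᶜ)ᶜ, compl_subset_comm.1 (subset_toMeasurable ν Aᶜ),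
    (measurableSet_toMeasurable _ _).compl, ?_⟩
  rw [IsConull, compl_compl, C.isNull_iff hν, measure_toMeasurable]
  exact hA ν hν

theorem not_isNull_inter {C : MeasureClass α} {A B : Set α} (hA : ¬ C.IsNull A)
    (hB : C.IsConull B) : ¬ C.IsNull (A ∩ B) := fun h =>
  hA ((h.union hB).mono fun x hx => (em (x ∈ B)).imp (fun h => ⟨hx, h⟩) id)

theorem IsConull.not_isNull {C : MeasureClass α} {A : Set α} (hA : C.IsConull A) :
    ¬ C.IsNull A := by
  intro h
  obtain ⟨ν, hν, hp⟩ := C.exists_isProbabilityMeasure_mem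
  have h1 := (h.union hA) ν hν
  rw [union_compl_self, measure_univ] at h1
  exact one_ne_zero h1

theorem map_mem_map {β : Type v} [MeasurableSpace β] (C : MeasureClass α) {f : α → β}
    (hf : Measurable f) {ν : Measure α} (hν : ν ∈ C.carrier) [IsProbabilityMeasure ν] :
    ν.map f ∈ (C.map f hf).carrier := by
  have := Measure.isProbabilityMeasure_map (μ := ν) hf.aemeasurable
  exact ⟨inferInstance, ν, hν, inferInstance, .rfl, .rfl⟩

end MeasureClass

namespace Arr

variable {X : Type u} [Groupoid.{v} X]

theorem saturation_eq_image (A : Set X) : saturation A = Arr.src '' (Arr.rng ⁻¹' A) := rfl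

theorem subset_saturation (A : Set X) : A ⊆ saturation A := fun x hx => ⟨unit x, hx, rfl⟩

theorem mem_saturation_of_hom {A : Set X} {x y : X} (g : y ⟶ x) (hx : x ∈ saturation A) :
    y ∈ saturation A := by
  obtain ⟨⟨_, z, g'⟩, hz, rfl⟩ := hx
  exact ⟨⟨y, z, g ≫ g'⟩, hz, rfl⟩

theorem disjoint_saturation_of_disjoint {A B : Set X} (h : Disjoint A (saturation B)) :
    Disjoint (saturation A) (saturation B) := by
  refine disjoint_left.2 ?_
  rintro _ ⟨γ, hγ, rfl⟩ hB
  exact disjoint_left.1 h hγ (mem_saturation_of_hom (Groupoid.inv γ.hom) hB)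

theorem saturation_iUnion (s : ℕ → Set X) : saturation (⋃ n, s n) = ⋃ n, saturation (s n) := by
  simp only [saturation_eq_image, preimage_iUnion, image_iUnion]

end Arr

section Reductions

variable {X : Type u} [Groupoid.{v} X] [MeasurableSpace X] [MeasurableSpace (Arr X)]
  [BorelGroupoid X] {C : MeasureClass (Arr X)}

/-- Ranges avoid a null set by definition of `r(C)`, and sources do so by symmetry of `C`. -/
theorem IsMeasuredGroupoid.isConull_reduction (hC : IsMeasuredGroupoid C) {V : Set X}
    (hV : C.range.IsConull V) : C.IsConull (Arr.reduction V) := by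
  obtain ⟨W, hWV, hW, hWc⟩ := hV.exists_measurableSet_subset
  obtain ⟨ν, hν, hp⟩ := C.exists_isProbabilityMeasure_mem
  have hr := BorelGroupoid.measurable_rng (X := X)
  have h1 : ν (Arr.rng ⁻¹' Wᶜ) = 0 := by
    rw [← Measure.map_apply hr hW.compl]
    exact hWc _ (C.map_mem_map hr hν)
  have h2 : ν (Arr.src ⁻¹' Wᶜ) = 0 := by
    have := (hC.symmetric ν hν).1 h1
    rwa [Measure.map_apply BorelGroupoid.measurable_inv (hr hW.compl)] at this
  refine (C.isNull_iff hν).2 (measure_mono_null ?_ (measure_union_null h1 h2))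
  intro γ hγ
  by_contra h
  simp only [mem_union, mem_preimage, mem_compl_iff, not_or, not_not] at h
  exact hγ ⟨hWV h.1, hWV h.2⟩

/-- Every element of some inessential reduction is of the form `γ₁γ₂⁻¹` with `γ₁` and
`γ₂` in a given conull set. -/
theorem IsMeasuredGroupoid.exists_mul_mem (hC : IsMeasuredGroupoid C) {D : Set (Arr X)}
    (hD : C.IsConull D) : ∃ U : Set X, C.range.IsConull U ∧ ∀ γ ∈ Arr.reduction U,
      ∃ (γ' : Arr X) (h : γ'.rng = γ.src), γ' ∈ D ∧ γ.mul γ' h ∈ D := by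
  have := BorelGroupoid.standardBorel_units (X := X)
  have hr := BorelGroupoid.measurable_rng (X := X)
  obtain ⟨ν, hν, hp, κ, hκ, U, hU, hUκ⟩ := hC.invariant
  obtain ⟨D', hDD', hD'm, hD'c⟩ := hD.exists_measurableSet_subset
  have hμ := C.map_mem_map hr hν
  have hmk := hκ.isMarkov
  have h1 : ∀ᵐ x ∂(ν.map Arr.rng), κ x D'ᶜ = 0 := by
    have h2 : ((ν.map Arr.rng).bind κ) D'ᶜ = 0 := by
      rw [hκ.bind_eq]
      exact hD'c ν hν
    rw [Measure.bind_apply hD'm.compl κ.aemeasurable] at h2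
    exact (lintegral_eq_zero_iff (κ.measurable_coe hD'm.compl)).1 h2
  have h2 : C.range.IsConull {x | κ x D'ᶜ = 0 ∧ κ x {γ | γ.rng = x}ᶜ = 0} :=
    (C.range.isNull_iff hμ).2 (h1.and hκ.ae_fibre)
  refine ⟨_, hU.inter h2, fun γ hγ => ?_⟩
  obtain ⟨⟨hrU, hr1, -⟩, hsU, hs1, hs2⟩ := hγ
  -- Invariance: since `κ γ.rng` does not charge the complement of `D'`, `γγ'` lies in `D'` for `κ
  -- γ.src`-almost every `γ'`.
  have h3 := (hUκ γ ⟨hrU, hsU⟩).1 hr1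
  have hS : MeasurableSet {γ' : Arr X | γ'.rng = γ.src} := hr (measurableSet_singleton γ.src)
  have hmul : Measurable
      (fun γ' : {γ' : Arr X // γ'.rng = γ.src} => Arr.mul γ γ'.1 γ'.2) := by
    have h4 : Measurable (fun γ' : {γ' : Arr X // γ'.rng = γ.src} =>
        (⟨(γ, γ'.1), γ'.2⟩ : {p : Arr X × Arr X // p.2.rng = p.1.src})) :=
      (measurable_const.prodMk measurable_subtype_coe).subtype_mk
    exact BorelGroupoid.measurable_mul.comp h4
  have hemb : MeasurableEmbedding (Subtype.val : {γ' : Arr X // γ'.rng = γ.src} → Arr X) :=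
    MeasurableEmbedding.subtype_coe hS
  rw [Arr.translate, Measure.map_apply hmul hD'm.compl, hemb.comap_apply] at h3
  by_contra hcon
  push Not at hcon
  have h5 : κ γ.src univ = 0 := by
    refine measure_mono_null ?_ (measure_union_null (measure_union_null hs1 hs2) h3)
    intro γ' _
    by_contra hγ'
    simp only [mem_union, not_or, mem_compl_iff, not_not] at hγ'
    obtain ⟨⟨hD1, hrs⟩, hn⟩ := hγ'
    exact hn ⟨⟨γ', hrs⟩, fun hm => hcon γ' hrs (hDD' hD1) (hDD' hm), rfl⟩
  rw [measure_univ] at h5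
  exact one_ne_zero h5

/-- In an ergodic measured groupoid the saturation of a set of positive measure is conull. -/
theorem IsErgodic.isConull_saturation (hC : IsErgodic C) {E : Set X} (hE : MeasurableSet E)
    (hE0 : ¬ C.range.IsNull E) : C.range.IsConull (Arr.saturation E) := by
  have := BorelGroupoid.standardBorel_units (X := X)
  have := BorelGroupoid.standardBorel_arr (X := X)
  have hr := BorelGroupoid.measurable_rng (X := X)
  have hs := BorelGroupoid.measurable_src (X := X)
  obtain ⟨μ, hμ, hp⟩ := C.range.exists_isProbabilityMeasure_mem
  -- `T` is a Borel core of the complement of the saturation. An invariant Borel `B` containing `E`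
  -- and missing `T` must be conull, so `T` is null.
  obtain ⟨T, hTs, hT, hTae⟩ :=
    ((hr hE).nullMeasurableSet_image μ hs).compl.exists_measurable_subset_ae_eq
  let _ := upgradeStandardBorel X
  have hd : Disjoint (Arr.saturation E) (Arr.saturation T) := by
    refine (Arr.disjoint_saturation_of_disjoint ?_).symm
    exact disjoint_left.2 fun x hx hx' => hTs hx hx'
  obtain ⟨B, hB, hBinv, hEB, hBT⟩ := exists_measurableSet_eq_of_disjoint (q := Arr.saturation)
    (fun s h => (hr h).analyticSet_image hs) Arr.subset_saturation Arr.saturation_iUnion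
    ((hr hE).analyticSet_image hs) ((hr hT).analyticSet_image hs) hd
    (fun s h => Arr.disjoint_saturation_of_disjoint h)
  have hBc : C.range.IsConull B := (hC B hB hBinv).resolve_left fun h =>
    hE0 (h.mono ((Arr.subset_saturation E).trans hEB))
  refine (C.range.isNull_iff hμ).2 ?_
  rw [Arr.saturation_eq_image, ← measure_congr hTae]
  exact measure_mono_null
    (fun x hx hxB => disjoint_left.1 hBT hxB (Arr.subset_saturation T hx)) (hBc μ hμ)

end Reductions

/-! ### Cocycles and coboundaries -/

section Cocycles

open scoped ENNReal

variable {X : Type u} [Groupoid.{v} X] [MeasurableSpace X] [MeasurableSpace (Arr X)]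
  [BorelGroupoid X] {C : MeasureClass (Arr X)} {𝕜 : Type*} [RCLike 𝕜] {H : X → Type w}
  [MeasurableSpace (BundleTotal H)] [∀ x, NormedAddCommGroup (H x)]
  [∀ x, InnerProductSpace 𝕜 (H x)] {L : MeasuredRep 𝕜 H C} {b : ∀ ⦃x y : X⦄, (x ⟶ y) → H y}

/-- On some Borel inessential reduction, the representation is isometric and multiplicative and the
cocycle identity holds everywhere. -/
theorem IsCocycle.exists_measurableSet_reduction (hb : IsCocycle L b) :
    ∃ U : Set X, MeasurableSet U ∧ C.range.IsConull U ∧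
      (∀ ⦃x y : X⦄, x ∈ U → y ∈ U → ∀ γ : x ⟶ y,
        Isometry (L.op γ) ∧ Function.Surjective (L.op γ)) ∧
      (∀ ⦃x y z : X⦄, x ∈ U → y ∈ U → z ∈ U → ∀ (γ₁ : y ⟶ z) (γ₂ : x ⟶ y) (v : H x),
        L.op (γ₂ ≫ γ₁) v = L.op γ₁ (L.op γ₂ v)) ∧
      (∀ ⦃x y z : X⦄, x ∈ U → y ∈ U → z ∈ U → ∀ (γ₁ : y ⟶ z) (γ₂ : x ⟶ y),
        b (γ₂ ≫ γ₁) = b γ₁ + L.op γ₁ (b γ₂)) := by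
  obtain ⟨U₁, h1, hiso, -, hmul⟩ := L.exists_reduction
  obtain ⟨U₂, h2, hcoc⟩ := hb.exists_reduction
  obtain ⟨U, hU, hUm, hUc⟩ := (h1.inter h2).exists_measurableSet_subset
  exact ⟨U, hUm, hUc, fun x y hx hy => hiso (hU hx).1 (hU hy).1,
    fun x y z hx hy hz => hmul (hU hx).1 (hU hy).1 (hU hz).1,
    fun x y z hx hy hz => hcoc (hU hx).2 (hU hy).2 (hU hz).2⟩

/-- A cocycle that is almost everywhere the coboundary of `ξ` is the coboundary of `ξ` everywhere on
some inessential reduction. -/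
theorem IsCocycle.exists_reduction_eq (hC : IsMeasuredGroupoid C) (hb : IsCocycle L b)
    {ξ : ∀ x, H x} (hξ : C.AE (fun γ => b γ.hom = ξ γ.rng - L.op γ.hom (ξ γ.src))) :
    ∃ U : Set X, C.range.IsConull U ∧ ∀ ⦃x y : X⦄, x ∈ U → y ∈ U → ∀ g : x ⟶ y,
      b g = ξ y - L.op g (ξ x) := by
  obtain ⟨U, -, hUc, -, hmul, hcoc⟩ := hb.exists_measurableSet_reduction
  obtain ⟨U', hU'c, hU'⟩ := hC.exists_mul_mem ((hC.isConull_reduction hUc).inter hξ)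
  refine ⟨U ∩ U', hUc.inter hU'c, fun x y hx hy g => ?_⟩
  obtain ⟨⟨z, x', g'⟩, h, ⟨⟨-, hz⟩, h1⟩, -, h2⟩ := hU' ⟨x, y, g⟩ ⟨hy.2, hx.2⟩
  obtain rfl : x' = x := h
  simp only [Arr.mul, eqToHom_refl, Category.id_comp, mem_ofPred_eq] at h1 h2
  rw [hcoc hz hx.1 hy.1, hmul hz hx.1 hy.1, h1, map_sub] at h2
  rw [eq_sub_iff_add_eq] at h2 ⊢
  rw [← h2]
  abel

theorem IsCoboundary.isBoundedOnReduction [IsHilbertBundle H 𝕜] (hC : IsMeasuredGroupoid C)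
    (hb : IsCocycle L b) (h : IsCoboundary L b) : IsBoundedOnReduction C b := by
  have := BorelGroupoid.standardBorel_units (X := X)
  obtain ⟨ξ, hξ, hae⟩ := h
  obtain ⟨U₁, hU₁c, hU₁⟩ := hb.exists_reduction_eq hC hae
  obtain ⟨U₂, -, hU₂c, hiso, -⟩ := hb.exists_measurableSet_reduction
  obtain ⟨U, hU, hUm, hUc⟩ := (hU₁c.inter hU₂c).exists_measurableSet_subset
  let E : ℕ → Set X := fun n => U ∩ {x | ‖ξ x‖ ≤ n}
  have hE : ⋃ n, E n = U := by
    refine Subset.antisymm (iUnion_subset fun n => inter_subset_left) fun x hx => ?_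
    obtain ⟨n, hn⟩ := exists_nat_ge ‖ξ x‖
    exact mem_iUnion.2 ⟨n, hx, hn⟩
  obtain ⟨n, hn⟩ : ∃ n, ¬ C.range.IsNull (E n) := by
    by_contra! hcon
    refine hUc.not_isNull fun μ hμ => ?_
    rw [← hE]
    exact measure_iUnion_null fun n => hcon n μ hμ
  refine ⟨E n, hUm.inter (measurableSet_le (hξ.measurable_norm (𝕜 := 𝕜)) measurable_const), hn,
    n + n, ?_⟩
  rintro _ ⟨γ, ⟨⟨hr, hr'⟩, hs, hs'⟩, rfl⟩
  change ‖b γ.hom‖ ≤ _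
  rw [hU₁ (hU hs).1 (hU hr).1]
  refine (norm_sub_le _ _).trans (add_le_add hr' ?_)
  rw [(hiso (hU hs).2 (hU hr).2 γ.hom).1.norm_map_of_map_zero (map_zero _)]
  exact hs'

/-- The set of values of `b` at the elements with range `x` and source in `E`. -/
def cocycleValues (b : ∀ ⦃x y : X⦄, (x ⟶ y) → H y) (E : Set X) (x : X) : Set (H x) :=
  {w | ∃ (y : X) (g : y ⟶ x), y ∈ E ∧ b g = w}

/-- The distances from Borel sections to the values of a cocycle are almost everywhere measurable. -/
theorem IsCocycle.aemeasurable_supDist [IsHilbertBundle H 𝕜] (hb : IsCocycle L b) {E : Set X}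
    (hE : MeasurableSet E) {η : ∀ x, H x} (hη : IsBorelSection H η) (μ : Measure X)
    [IsFiniteMeasure μ] : AEMeasurable (fun x => supDist (cocycleValues b E x) (η x)) μ := by
  have := BorelGroupoid.standardBorel_units (X := X)
  have := BorelGroupoid.standardBorel_arr (X := X)
  have hr := BorelGroupoid.measurable_rng (X := X)
  have hs := BorelGroupoid.measurable_src (X := X)
  have hn : NullMeasurable (fun x => supDist (cocycleValues b E x) (η x)) μ := by
    refine measurable_of_Ioi (α := ℝ≥0∞) (δ := NullMeasurableSpace X μ) fun t => ?_
    -- A supremum exceeds `t` exactly when some element does, so the superlevel set is the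
    -- projection of a Borel set.
    have h1 : (fun x => supDist (cocycleValues b E x) (η x)) ⁻¹' Ioi t =
        Arr.rng '' {γ : Arr X | γ.src ∈ E ∧ t < ENNReal.ofReal ‖b γ.hom - η γ.rng‖} := by
      ext x
      simp only [mem_preimage, mem_Ioi, supDist, lt_iSup_iff, mem_image, mem_ofPred_eq,
        cocycleValues]
      constructor
      · rintro ⟨_, ⟨y, g, hy, rfl⟩, h⟩
        rw [edist_dist, dist_eq_norm] at h
        exact ⟨⟨y, x, g⟩, ⟨hy, h⟩, rfl⟩
      · rintro ⟨⟨y, x, g⟩, ⟨hy, h⟩, rfl⟩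
        rw [← dist_eq_norm, ← edist_dist] at h
        exact ⟨_, ⟨y, g, hy, rfl⟩, h⟩
    change NullMeasurableSet ((fun x => supDist (cocycleValues b E x) (η x)) ⁻¹' Ioi t) μ
    rw [h1]
    refine MeasurableSet.nullMeasurableSet_image μ hr ((hs hE).inter ?_)
    exact measurableSet_lt measurable_const
      ((hη.measurable_norm_sub (𝕜 := 𝕜)).comp hb.borel).ennreal_ofReal
  exact hn.aemeasurable

/-- If the sets of values of a cocycle are nonempty and bounded almost everywhere, then there is a
Borel section that consists of their Chebyshev centers almost everywhere. -/
theorem IsCocycle.exists_isBorelSection_isChebyshevCenter [hH : IsHilbertBundle H 𝕜]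
    (hb : IsCocycle L b) {E V : Set X} (hE : MeasurableSet E) (hV : C.range.IsConull V)
    (hne : ∀ x ∈ V, (cocycleValues b E x).Nonempty)
    (hfin : ∀ x ∈ V, ⨅ v, supDist (cocycleValues b E x) v ≠ ⊤) :
    ∃ ξ : ∀ x, H x, IsBorelSection H ξ ∧
      ∃ W ⊆ V, C.range.IsConull W ∧ ∀ x ∈ W, IsChebyshevCenter (cocycleValues b E x) (ξ x) := by
  classical
  have := BorelGroupoid.standardBorel_units (X := X)
  obtain ⟨μ, hμ, hp⟩ := C.range.exists_isProbabilityMeasure_mem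
  obtain ⟨ξ₀, hξ₀⟩ := hH.exists_fundamental
  obtain ⟨v, hv, hd⟩ := hξ₀.exists_denseRange
  choose φ hφm hφ using fun k => hb.aemeasurable_supDist hE (hv.isBorelSection k) μ
  have hae : C.range.IsConull {x | ∀ k, supDist (cocycleValues b E x) (v k x) = φ k x} :=
    (C.range.isNull_iff hμ).2 (ae_all_iff.2 hφ)
  obtain ⟨W, hW, hWm, hWc⟩ := (hV.inter hae).exists_measurableSet_subset
  have hRm : Measurable (fun x => ⨅ k, φ k x) := .iInf hφm
  have hex : ∀ (j : ℕ) (x : X), ∃ k, φ k x ≤ (⨅ k, φ k x) + ENNReal.ofReal (1 / (j + 1)) := by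
    intro j x
    -- The index must exist at every `x`, including points outside `W` where the infimum may be
    -- infinite; any index then works.
    by_cases h : ⨅ k, φ k x = ⊤
    · exact ⟨0, by rw [h, top_add]; exact le_top⟩
    · obtain ⟨k, hk⟩ := iInf_lt_iff.1 (ENNReal.lt_add_right h
        (ENNReal.ofReal_pos.2 (show (0 : ℝ) < 1 / (j + 1) by positivity)).ne')
      exact ⟨k, hk.le⟩
  -- Taking the least near-minimizing index makes the choice Borel; the resulting sections converge
  -- to the center on `W`.
  let K : ℕ → X → ℕ := fun j x => Nat.find (hex j x)
  have hKm : ∀ j, Measurable (K j) := fun j => measurable_find _ fun k =>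
    measurableSet_le (hφm k) (hRm.add_const _)
  have hlim : ∀ x ∈ W, ∃ c, Tendsto (fun j => v (K j x) x) atTop (𝓝 c) ∧
      IsChebyshevCenter (cocycleValues b E x) c := by
    intro x hx
    have := hH.completeSpace x
    refine exists_tendsto_isChebyshevCenter 𝕜 (hne x (hW hx).1) (hfin x (hW hx).1) fun j => ?_
    rw [← iInf_supDist_of_denseRange _ (hd x)]
    simp only [(hW hx).2 _]
    exact Nat.find_spec (hex j x)
  choose! c hc hcc using hlim
  refine ⟨fun x => if x ∈ W then c x else 0, hv.isBorelSection_iff.2 fun n => ?_, W,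
    fun x hx => (hW hx).1, hWc, fun x hx => by simpa [hx] using hcc x hx⟩
  have hm : ∀ j, Measurable
      (W.indicator fun x => (inner 𝕜 (v n x) (v (K j x) x) : 𝕜)) := by
    intro j
    have h1 : Measurable (fun p : ℕ × X => (inner 𝕜 (v n p.2) (v p.1 p.2) : 𝕜)) :=
      measurable_from_prod_countable_right fun k => hv.measurable_gram n k
    exact (h1.comp ((hKm j).prodMk measurable_id)).indicator hWm
  refine measurable_of_tendsto_metrizable hm (tendsto_pi_nhds.2 fun x => ?_)
  by_cases hx : x ∈ W
  · simpa [hx] using (tendsto_const_nhds (x := v n x)).inner (𝕜 := 𝕜) (hc x hx)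
  · simp [hx]

theorem IsBoundedOnFibres.isCoboundary [IsHilbertBundle H 𝕜] (hC : IsMeasuredGroupoid C)
    (he : IsErgodic C) (hb : IsCocycle L b) (h : IsBoundedOnFibres C b) : IsCoboundary L b := by
  obtain ⟨E, hE, hE0, hbdd⟩ := h
  obtain ⟨U, hUm, hUc, hiso, hmul, hcoc⟩ := hb.exists_measurableSet_reduction
  -- Cutting down to `U` keeps positive measure and makes the cocycle identity available at every
  -- unit involved.
  have hEU : MeasurableSet (E ∩ U) := hE.inter hUm
  have hsat := he.isConull_saturation hEU (MeasureClass.not_isNull_inter hE0 hUc)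
  let B := cocycleValues b (E ∩ U)
  let e : ∀ {y x : X}, (y ⟶ x) → H y → H x := fun g w => b g + L.op g w
  have heiso : ∀ {y x : X}, y ∈ U → x ∈ U → ∀ g : y ⟶ x, Isometry (e g) := fun hy hx g =>
    (isometry_add_left (b g)).comp (hiso hy hx g).1
  have hesurj : ∀ {y x : X}, y ∈ U → x ∈ U → ∀ g : y ⟶ x, Function.Surjective (e g) :=
    fun hy hx g => (add_left_surjective (b g)).comp (hiso hy hx g).2
  have hB : ∀ {y x : X}, y ∈ U → x ∈ U → ∀ g : y ⟶ x, e g '' B y = B x := by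
    intro y x hy hx g
    refine Subset.antisymm ?_ ?_
    · rintro _ ⟨_, ⟨z, g', hz, rfl⟩, rfl⟩
      exact ⟨z, g' ≫ g, hz, hcoc hz.2 hy hx g g'⟩
    · rintro _ ⟨z, g', hz, rfl⟩
      refine ⟨_, ⟨z, g' ≫ Groupoid.inv g, hz, rfl⟩, ?_⟩
      change b g + L.op g (b (g' ≫ Groupoid.inv g)) = _
      rw [← hcoc hz.2 hy hx, Category.assoc, Groupoid.inv_comp, Category.comp_id]
  have hsatmem : ∀ x ∈ Arr.saturation (E ∩ U), ∃ (y : X) (_ : y ⟶ x), y ∈ E ∩ U := by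
    rintro _ ⟨γ, hγ, rfl⟩
    exact ⟨γ.rng, Groupoid.inv γ.hom, hγ⟩
  have hne : ∀ x ∈ Arr.saturation (E ∩ U) ∩ U, (B x).Nonempty := by
    rintro x ⟨hx, -⟩
    obtain ⟨y, g, hy⟩ := hsatmem x hx
    exact ⟨_, y, g, hy, rfl⟩
  have hfin : ∀ x ∈ Arr.saturation (E ∩ U) ∩ U, ⨅ v, supDist (B x) v ≠ ⊤ := by
    rintro x ⟨hx, hxU⟩
    obtain ⟨y, g, hy⟩ := hsatmem x hx
    obtain ⟨M, hM⟩ := hbdd y hy.1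
    -- The ball of radius `M` around `0` contains `B y`; its affine image is centered at `e g 0` and
    -- contains `B x`.
    refine ne_top_of_le_ne_top ?_ (iInf_le _ (e g 0))
    rw [← hB hy.2 hxU g, supDist_image (heiso hy.2 hxU g)]
    refine ne_top_of_le_ne_top (ENNReal.ofReal_ne_top (r := M)) (iSup₂_le ?_)
    rintro _ ⟨z, g', hz, rfl⟩
    rw [edist_dist, dist_zero_right]
    exact ENNReal.ofReal_le_ofReal (hM ⟨⟨z, y, g'⟩, ⟨rfl, hz.1⟩, rfl⟩)
  obtain ⟨ξ, hξ, W, hWV, hWc, hW⟩ :=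
    hb.exists_isBorelSection_isChebyshevCenter hEU (hsat.inter hUc) hne hfin
  refine ⟨ξ, hξ, (hC.isConull_reduction hWc).mono ?_⟩
  rintro ⟨y, x, g⟩ ⟨hx, hy⟩
  have h1 : IsChebyshevCenter (B x) (e g (ξ y)) := by
    rw [← hB (hWV hy).2 (hWV hx).2 g]
    exact (hW y hy).image (heiso (hWV hy).2 (hWV hx).2 g) (hesurj (hWV hy).2 (hWV hx).2 g)
  have h2 : supDist (B x) (ξ x) ≠ ⊤ :=
    ne_top_of_le_ne_top (hfin x (hWV hx)) (le_iInf (hW x hx))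
  -- The transported center and the chosen one are both centers of `B x`, so uniqueness gives
  -- equivariance.
  have h3 : ξ x = b g + L.op g (ξ y) := (hW x hx).eq 𝕜 (hne x (hWV hx)) h1 h2
  change b g = ξ x - L.op g (ξ y)
  rw [h3, add_sub_cancel_right]

end Cocycles

theorem IsBoundedOnReduction.isBoundedOnFibres {X : Type u} [Groupoid.{v} X] [MeasurableSpace X]
    [MeasurableSpace (Arr X)] [BorelGroupoid X] {H : X → Type w} [∀ x, NormedAddCommGroup (H x)]
    {C : MeasureClass (Arr X)} {b : ∀ ⦃x y : X⦄, (x ⟶ y) → H y} (h : IsBoundedOnReduction C b) :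
    IsBoundedOnFibres C b := by
  obtain ⟨E, hE, hE0, hbdd⟩ := h
  refine ⟨E, hE, hE0, fun x hx => hbdd.mono (image_mono ?_)⟩
  rintro γ ⟨rfl, hs⟩
  exact ⟨hx, hs⟩

end Preliminaries

theorem theorem3 {X : Type u} [Groupoid.{v} X] [MeasurableSpace X] [MeasurableSpace (Arr X)]
    [BorelGroupoid X] (C : MeasureClass (Arr X)) (hC : IsMeasuredGroupoid C)
    {𝕜 : Type*} [RCLike 𝕜] (H : X → Type w)
    [∀ x, NormedAddCommGroup (H x)] [∀ x, InnerProductSpace 𝕜 (H x)]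
    [MeasurableSpace (BundleTotal H)] [IsHilbertBundle H 𝕜]
    (L : MeasuredRep 𝕜 H C) (b : ∀ ⦃x y : X⦄, (x ⟶ y) → H y) (hb : IsCocycle L b) :
    (IsCoboundary L b → IsBoundedOnReduction C b) ∧
    (IsBoundedOnReduction C b → IsBoundedOnFibres C b) ∧
    (IsErgodic C → IsRDiscrete C →
      [IsCoboundary L b, IsBoundedOnReduction C b, IsBoundedOnFibres C b].TFAE) := by
  refine ⟨fun h => h.isBoundedOnReduction hC hb, fun h => h.isBoundedOnFibres, fun he _ => ?_⟩
  tfae_have 1 → 2 := fun h => h.isBoundedOnReduction hC hb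
  tfae_have 2 → 3 := fun h => h.isBoundedOnFibres
  tfae_have 3 → 1 := fun h => h.isCoboundary hC he hb
  tfae_finish
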